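/- **Theorem (Regular Reduction).** Let $\ell\ge 0$, let $b_0<\dots<b_\ell$ be real numbers with multiplicities $m_0,\dots,m_\ell\ge 1$, and put $n+1=\sum_\sigma m_\sigma$. Split the coordinates of $\mathbb R^{n+1}$ into consecutive index sets $I_\sigma$ of size $m_\sigma$, with coordinate projections $P_\sigma$. The group $G=O(m_0)\times\dots\times O(m_\ell)$ acts on $T^*\mathbb R^{n+1}$ by $(x,y)\mapsto(gx,gy)$, and $\widetilde G\subseteq G$ is the subgroup of the factors with $m_\sigma\ge 2$. Its momentum mapping $J=(J_\sigma)_\sigma$ has values in $\prod_\sigma\mathfrak{so}(m_\sigma)$ (identified with its dual), where $J_\sigma(x,y)$ is the skew matrix with entries $L_{ik}=x_iy_k-x_ky_i$, $i,k\in I_\sigma$. Put $W_\sigma=\sum_{i<k\in I_\sigma}L_{ik}^2$, so that $W_\sigma=0$ if $m_\sigma=1$; $W_\sigma$ is a function of $J_\sigma$. Let $[\cdot,\cdot]$ be the canonical bracket on $T^*\mathbb R^{d}$, $[x_i,y_k]=\delta_{ik}$, and let $$\{f,g\}=[f,g]+\tfrac1{2C_1}[f,C_1][C_2,g]-\tfrac1{2C_1}[f,C_2][C_1,g],\qquad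 C_1=\langle x,x\rangle,\quad C_2=\langle x,y\rangle ,$$ be the Dirac bracket, defined where $x\ne0$. Embed $T^*S^{d-1}=\{C_1=1,\ C_2=0\}\subset T^*\mathbb R^{d}$. The Hamiltonian of the degenerate Neumann system on $T^*S^n$ is $H=\frac12\langle y,y\rangle+\frac12\sum_\sigma b_\sigma\|P_\sigma x\|^2$. Define $R(x,y)=(\xi,\eta)\in T^*\mathbb R^{\ell+1}$ by $$\xi_\sigma=\|P_\sigma x\|,\quad \eta_\sigma=\frac{\langle P_\sigma x,P_\sigma y\rangle}{\|P_\sigma x\|}\quad (m_\sigma\ge2),\qquad \xi_\sigma=x_\sigma,\quad\eta_\sigma=y_\sigma\quad(m_\sigma=1),$$ where $x_\sigma,y_\sigma$ denote the single coordinates with index in $I_\sigma$ if $m_\sigma=1$. 1. On the set of all $(x,y)\in T^*\mathbb R^{n+1}$ with $x\neq 0$ and $W_\sigma(x,y)\ne0$ for every $\sigma$ with $m_\sigma\ge2$, the mapping $R$ is smooth, has $\xi\ne0$, and is a Poisson mapping for the Dirac brackets: $\{f\circ R,g\circ R\}_{2n+2}=\{f,g\}_{2\ell+2}\circ R$. 2.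 Let $\mu\in\prod_\sigma\mathfrak{so}(m_\sigma)$ with $\mu_\sigma\ne0$ whenever $m_\sigma\ge2$, put $L_\mu=\{p\in T^*S^n: J(p)=\mu\}$, and let $G_\mu$ and $\widetilde G_\mu=G_\mu\cap\widetilde G$ be the isotropy groups of $\mu$ under $\mu\mapsto g\mu g^{-1}$. Then $R$ induces a homeomorphism of the reduced phase space $P_\mu=L_\mu/\widetilde G_\mu$ onto an open subset $U=R(L_\mu)$ of $T^*S^\ell$; if $L_\mu\neq\emptyset$, then $U=\{(\xi,\eta)\in T^*S^\ell:\xi_\sigma>0\text{ whenever }m_\sigma\ge2\}$. This identification is a symplectic diffeomorphism: a function $f$ on $U$ is smooth if and only if $f\circ R$ is smooth on $L_\mu$, and $R^*\big(\sum_\sigma d\xi_\sigma\wedge d\eta_\sigma\big)$ agrees with $\sum_\nu dx_\nu\wedge dy_\nu$ on vectors tangent to $L_\mu$. If all $m_\sigma\ge2$, then $\widetilde G=G$. In general two points $p,q\in L_\mu$ lie in the same $G_\mu$-orbit if and only if $R(q)$ arises from $R(p)$ by sign changes $(\xi_\sigma,\eta_\sigma)\mapsto(-\xi_\sigma,-\eta_\sigma)$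 for some of the $\sigma$ with $m_\sigma=1$. 3. On $L_\mu$ one has $H=H_\mu\circ R$ with the Rosochatius Hamiltonian $$H_\mu(\xi,\eta)=\frac12\sum_{\sigma=0}^{\ell}\Big(\eta_\sigma^2+b_\sigma\xi_\sigma^2+\frac{W_\sigma}{\xi_\sigma^2}\Big),$$ where $W_\sigma=W_\sigma(\mu)$ and the term $W_\sigma/\xi_\sigma^2$ is absent (read as $0$) if $m_\sigma=1$. -/

import Mathlib

open scoped ContDiff

noncomputable section

namespace NeumannReduction

/-! ### The canonical bracket and the Dirac bracket on `T*ℝ^ι` -/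

/-- `T*ℝ^ι` with coordinates `(x, y)`. -/
abbrev Phase (ι : Type*) := EuclideanSpace ℝ ι × EuclideanSpace ℝ ι

section Bracket

variable {ι : Type*} [Fintype ι] [DecidableEq ι]

/-- `∂f/∂x_i` at `p`. -/
def dX (f : Phase ι → ℝ) (i : ι) (p : Phase ι) : ℝ :=
  fderiv ℝ f p (EuclideanSpace.single i 1, 0)

/-- `∂f/∂y_i` at `p`. -/
def dY (f : Phase ι → ℝ) (i : ι) (p : Phase ι) : ℝ :=
  fderiv ℝ f p (0, EuclideanSpace.single i 1)

/-- The canonical Poisson bracket, with `[x_i, y_k] = δ_ik`. -/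
def canonicalBracket (f g : Phase ι → ℝ) (p : Phase ι) : ℝ :=
  ∑ i, (dX f i p * dY g i p - dY f i p * dX g i p)

/-- The constraint function `C₁ = ⟨x, x⟩`. -/
def C₁ (p : Phase ι) : ℝ := inner ℝ p.1 p.1

/-- The constraint function `C₂ = ⟨x, y⟩`. -/
def C₂ (p : Phase ι) : ℝ := inner ℝ p.1 p.2

/-- The Dirac bracket for the constraints `C₁`, `C₂`; it is meaningful where `x ≠ 0`. -/
def diracBracket (f g : Phase ι → ℝ) (p : Phase ι) : ℝ :=
  canonicalBracket f g p
    + 1 / (2 * C₁ p) * canonicalBracket f C₁ p * canonicalBracket C₂ g p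
    - 1 / (2 * C₁ p) * canonicalBracket f C₂ p * canonicalBracket C₁ g p

/-- The cotangent bundle of the unit sphere in `ℝ^ι`, embedded in `T*ℝ^ι`. -/
def cotangentSphere (ι : Type*) [Fintype ι] : Set (Phase ι) :=
  {p | C₁ p = 1 ∧ C₂ p = 0}

/-- The canonical symplectic form `∑ dx_i ∧ dy_i` on `T*ℝ^ι`. -/
def symplecticForm (v w : Phase ι) : ℝ := inner ℝ v.1 w.2 - inner ℝ w.1 v.2

end Bracket

/-! ### The degenerate Neumann system

The multiplicities are `m_0, …, m_ℓ`; the coordinates are indexed by pairs `(σ, i)` with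
`i < m_σ`, so that the block with first entry `σ` is the index set `I_σ`. -/

section Neumann

variable {ℓ : ℕ} (m : Fin (ℓ + 1) → ℕ)

/-- The index set of all coordinates, of cardinality `n + 1 = ∑ m_σ`. -/
abbrev Idx := Σ σ : Fin (ℓ + 1), Fin (m σ)

variable {m}

/-- The projection `P_σ` onto the coordinates with indices in `I_σ`. -/
def proj (σ : Fin (ℓ + 1)) (x : EuclideanSpace ℝ (Idx m)) : EuclideanSpace ℝ (Fin (m σ)) :=
  WithLp.toLp 2 fun i => x ⟨σ, i⟩

/-- The Hamiltonian `½⟨y, y⟩ + ½ ∑ b_σ ‖P_σ x‖²` of the degenerate Neumann system. -/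
def neumannHamiltonian (b : Fin (ℓ + 1) → ℝ) (p : Phase (Idx m)) : ℝ :=
  1 / 2 * inner ℝ p.2 p.2 + 1 / 2 * ∑ σ, b σ * ∑ i : Fin (m σ), p.1 ⟨σ, i⟩ ^ 2

variable (m)

/-- The symmetry group `G = O(m_0) × ⋯ × O(m_ℓ)`. -/
abbrev SymGroup := ∀ σ : Fin (ℓ + 1), Matrix.orthogonalGroup (Fin (m σ)) ℝ

/-- The Lie algebra `so(m_0) × ⋯ × so(m_ℓ)` of `G`, identified with its dual; the factors with
`m_σ = 1` vanish. -/
abbrev Momentum := ∀ σ : Fin (ℓ + 1), LieAlgebra.Orthogonal.so (Fin (m σ)) ℝ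

/-- The subgroup of `G` of the factors `O(m_σ)` with `m_σ ≥ 2`. -/
def tildeGroup : Subgroup (SymGroup m) where
  carrier := {g | ∀ σ, m σ < 2 → g σ = 1}
  one_mem' := fun _ _ => rfl
  mul_mem' := fun {g h} hg hh σ hσ => by simp [hg σ hσ, hh σ hσ]
  inv_mem' := fun {g} hg σ hσ => by simp [hg σ hσ]

variable {m}

/-- The block-diagonal action of `G` on `ℝ^{n+1}`. -/
def rot (g : SymGroup m) (x : EuclideanSpace ℝ (Idx m)) : EuclideanSpace ℝ (Idx m) :=
  WithLp.toLp 2 fun s => ((g s.1 : Matrix (Fin (m s.1)) (Fin (m s.1)) ℝ).mulVec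
    fun k => x ⟨s.1, k⟩) s.2

/-- The diagonal action `Φ_g (x, y) = (g x, g y)`. -/
def act (g : SymGroup m) (p : Phase (Idx m)) : Phase (Idx m) := (rot g p.1, rot g p.2)

lemma act_one (p : Phase (Idx m)) : act 1 p = p := by
  ext s <;> simp [act, rot]

lemma act_mul (g h : SymGroup m) (p : Phase (Idx m)) : act (g * h) p = act g (act h p) := by
  ext s <;> simp [act, rot, ← Matrix.mulVec_mulVec]

/-- The momentum mapping: in block `σ` the skew matrix `L_ik = x_i y_k - x_k y_i`,
`i, k ∈ I_σ`. -/
def momentumMap (p : Phase (Idx m)) : Momentum m := fun σ =>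
  ⟨Matrix.of fun i k => p.1 ⟨σ, i⟩ * p.2 ⟨σ, k⟩ - p.1 ⟨σ, k⟩ * p.2 ⟨σ, i⟩, by
    rw [LieAlgebra.Orthogonal.mem_so]
    ext i k
    simp⟩

/-- The Casimir `W_σ = ∑_{i < k} L_ik²` as a function on `so(m_0) × ⋯ × so(m_ℓ)`; an empty sum,
hence `0`, when `m_σ = 1`. -/
def casimir (μ : Momentum m) (σ : Fin (ℓ + 1)) : ℝ :=
  ∑ i : Fin (m σ), ∑ k ∈ Finset.Ioi i, (μ σ).1 i k ^ 2

/-- The isotropy group `G_μ` of `μ` under the coadjoint action `μ ↦ g μ g⁻¹`. -/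
def isotropy (μ : Momentum m) : Subgroup (SymGroup m) where
  carrier := {g | ∀ σ, (g σ : Matrix (Fin (m σ)) (Fin (m σ)) ℝ) * (μ σ).1 *
    ((g σ)⁻¹ : Matrix.orthogonalGroup (Fin (m σ)) ℝ) = (μ σ).1}
  one_mem' := fun σ => by simp
  mul_mem' := fun {g h} hg hh σ => by
    have h1 := hg σ
    have h2 := hh σ
    calc ((g * h) σ : Matrix (Fin (m σ)) (Fin (m σ)) ℝ) * (μ σ).1 *
          (((g * h) σ)⁻¹ : Matrix.orthogonalGroup (Fin (m σ)) ℝ)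
        = (g σ : Matrix (Fin (m σ)) (Fin (m σ)) ℝ) *
          ((h σ : Matrix (Fin (m σ)) (Fin (m σ)) ℝ) * (μ σ).1 *
            ((h σ)⁻¹ : Matrix.orthogonalGroup (Fin (m σ)) ℝ)) *
            ((g σ)⁻¹ : Matrix.orthogonalGroup (Fin (m σ)) ℝ) := by
          simp only [Pi.mul_apply, mul_inv_rev, Submonoid.coe_mul, Matrix.mul_assoc]
      _ = (μ σ).1 := by rw [h2, h1]
  inv_mem' := fun {g} hg σ => by
    have e1 : (((g σ)⁻¹ : Matrix.orthogonalGroup (Fin (m σ)) ℝ) :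
        Matrix (Fin (m σ)) (Fin (m σ)) ℝ) * (g σ : Matrix (Fin (m σ)) (Fin (m σ)) ℝ) = 1 := by
      rw [← Submonoid.coe_mul, inv_mul_cancel, Submonoid.coe_one]
    have h1 := hg σ
    simp only [Pi.inv_apply, inv_inv]
    conv_lhs => rw [← h1]
    simp only [Matrix.mul_assoc]
    rw [e1, ← Matrix.mul_assoc, e1, Matrix.mul_one, Matrix.one_mul]

/-- The points of `T*Sⁿ` with momentum `μ`. -/
def momentumLevel (μ : Momentum m) : Set (Phase (Idx m)) :=
  {p | p ∈ cotangentSphere (Idx m) ∧ momentumMap p = μ}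

/-- Two points with momentum `μ` are equivalent if an element of the subgroup `K` of `G` maps
the one to the other. -/
def orbitSetoid (K : Subgroup (SymGroup m)) (μ : Momentum m) : Setoid (momentumLevel μ) where
  r p q := ∃ g ∈ K, act g p.1 = q.1
  iseqv :=
    { refl := fun p => ⟨1, K.one_mem, act_one _⟩
      symm := fun {p q} ⟨g, hg, h⟩ => ⟨g⁻¹, K.inv_mem hg, by
        rw [← h, ← act_mul, inv_mul_cancel, act_one]⟩
      trans := fun {p q r} ⟨g, hg, h⟩ ⟨g', hg', h'⟩ => ⟨g' * g, K.mul_mem hg' hg, by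
        rw [act_mul, h, h']⟩ }

/-- The reduced phase space `P_μ = J⁻¹(μ) / G̃_μ`, where `G̃` is the subgroup of the factors with
`m_σ ≥ 2`; it carries the quotient topology. -/
abbrev ReducedSpace (μ : Momentum m) := Quotient (orbitSetoid (tildeGroup m ⊓ isotropy μ) μ)

/-- The reduction mapping `R : (x, y) ↦ (ξ, η)`. -/
def reduction (p : Phase (Idx m)) : Phase (Fin (ℓ + 1)) :=
  (WithLp.toLp 2 fun σ =>
    if h : m σ = 1 then p.1 ⟨σ, ⟨0, by omega⟩⟩ else ‖proj σ p.1‖,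
   WithLp.toLp 2 fun σ =>
    if h : m σ = 1 then p.2 ⟨σ, ⟨0, by omega⟩⟩
    else inner ℝ (proj σ p.1) (proj σ p.2) / ‖proj σ p.1‖)

variable (m) in
/-- The points of `T*ℝ^{n+1}` where the Dirac bracket is defined and `W_σ ≠ 0` for all `σ` with
`m_σ ≥ 2`. -/
def regularSet : Set (Phase (Idx m)) :=
  {p | p.1 ≠ 0 ∧ ∀ σ, 2 ≤ m σ → casimir (momentumMap p) σ ≠ 0}

/-- The Rosochatius Hamiltonian `½ ∑ (η_σ² + b_σ ξ_σ² + w_σ / ξ_σ²)`; a term with `w_σ = 0` is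
absent. -/
def rosochatiusHamiltonian (b w : Fin (ℓ + 1) → ℝ) (q : Phase (Fin (ℓ + 1))) : ℝ :=
  1 / 2 * ∑ σ, (q.2 σ ^ 2 + b σ * q.1 σ ^ 2 + w σ / q.1 σ ^ 2)

/-- Multiplication of the coordinates `(ξ_σ, η_σ)` by `ε_σ`. -/
def scaleBy (ε : Fin (ℓ + 1) → ℝ) (q : Phase (Fin (ℓ + 1))) : Phase (Fin (ℓ + 1)) :=
  (WithLp.toLp 2 fun σ => ε σ * q.1 σ, WithLp.toLp 2 fun σ => ε σ * q.2 σ)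

end Neumann

end NeumannReduction

end

/-!
The reduction mapping works block by block, and everything about a block `(P_σ x, P_σ y)` with
`m_σ ≥ 2` is encoded in its Gram matrix. By Lagrange's identity (`sum_wedge_sq`) the Casimir `W_σ`
is the Gram determinant, so that `(ξ_σ, η_σ, W_σ)` and the Gram matrix determine each other where
`P_σ x ≠ 0`. This yields `|P_σ y|² = η_σ² + W_σ / ξ_σ²` and with it the Rosochatius Hamiltonian.

*Poisson property.* The derivative of the reduction mapping sends `∂/∂x_s` to
`α_s ∂/∂ξ_σ + β_s ∂/∂η_σ` and `∂/∂y_s` to `α_s ∂/∂η_σ`, with `∑ α_s² = 1` in each block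
(`exists_fderiv_reduction_single`), so it preserves the canonical brackets. The constraint
functions satisfy `C₁ = C₁ ∘ R` and `C₂ = C₂ ∘ R`, whence it preserves the Dirac brackets too.

*Reduced space.* The orthogonal group is transitive on pairs of vectors with given Gram matrix
(`exists_isometry_of_gram_eq`), and an element of `G` that maps one point of `L_μ` to another fixes
`μ` by equivariance of `J`; therefore the fibres of `R` on `L_μ` are the orbits of the isotropy
group of `μ` in the product of the `O(m_σ)` with `m_σ ≥ 2`. If `L_μ` is not empty, then
`μ_σ = e_σ ∧ f_σ` with orthogonal vectors and `|e_σ| = 1`, and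
`(ξ, η) ↦ (ξ_σ e_σ, η_σ e_σ + ξ_σ⁻¹ f_σ)` is a smooth section of `R` (`frameLift`) with values in
`L_μ`. It provides the continuous inverse on the quotient, the description of the image, and the
comparison of the smooth functions.

*Symplectic form.* A vector `(a, b)` tangent to `L_μ` satisfies `a ∧ y + x ∧ b = 0` in each block.
Contraction with `x` expresses `|x|² b` by `a`, `x` and `y` (`inner_eq_of_wedge_eq_zero`), and with
this substitution the two symplectic forms agree identically.
-/

namespace NeumannReduction

/-! ### Pairs of vectors in a Euclidean space -/

section Pairs

lemma sum_fin_of_eq_one {k : ℕ} (h : k = 1) (f : Fin k → ℝ) :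
    ∑ i, f i = f ⟨0, by omega⟩ := by
  subst h
  simp

lemma euclidean_inner_eq_sum {ι : Type*} [Fintype ι] (x y : EuclideanSpace ℝ ι) :
    inner ℝ x y = ∑ i, x i * y i := by
  simp [PiLp.inner_apply, mul_comm]

/-- A function of two indices that is symmetric and vanishes on the diagonal is summed twice over
the pairs `i < k`. -/
lemma two_mul_sum_Ioi {k : ℕ} (F : Fin k → Fin k → ℝ) (hs : ∀ i j, F i j = F j i)
    (hd : ∀ i, F i i = 0) :
    2 * ∑ i, ∑ j ∈ Finset.Ioi i, F i j = ∑ i, ∑ j, F i j := by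
  have hsplit : ∀ i, ∑ j, F i j = ∑ j ∈ Finset.Ioi i, F i j + ∑ j ∈ Finset.Iio i, F i j := by
    intro i
    have hu : (Finset.univ : Finset (Fin k)) =
        insert i (Finset.Ioi i ∪ Finset.Iio i) := by
      ext j
      simp only [Finset.mem_univ, Finset.mem_insert, Finset.mem_union, Finset.mem_Ioi,
        Finset.mem_Iio, true_iff]
      rcases lt_trichotomy i j with h | h | h <;> simp [h]
    rw [hu, Finset.sum_insert (by simp), hd, zero_add, Finset.sum_union]
    rw [Finset.disjoint_left]
    intro j h1 h2
    simp only [Finset.mem_Ioi, Finset.mem_Iio] at h1 h2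
    exact absurd h1 (not_lt.mpr h2.le)
  have hswap : ∑ i, ∑ j ∈ Finset.Iio i, F i j = ∑ i, ∑ j ∈ Finset.Ioi i, F i j := by
    rw [Finset.sum_comm' (t' := Finset.univ) (s' := fun j => Finset.Ioi j) (by simp)]
    exact Finset.sum_congr rfl fun i _ => Finset.sum_congr rfl fun j _ => hs _ _
  rw [Finset.sum_congr rfl fun i _ => hsplit i, Finset.sum_add_distrib, hswap, two_mul]

/-- Lagrange's identity. -/
lemma sum_wedge_sq {k : ℕ} (x y : EuclideanSpace ℝ (Fin k)) :
    ∑ i, ∑ j ∈ Finset.Ioi i, (x i * y j - x j * y i) ^ 2 =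
      inner ℝ x x * inner ℝ y y - inner ℝ x y ^ 2 := by
  have h := two_mul_sum_Ioi (fun i j => (x i * y j - x j * y i) ^ 2) (fun i j => by ring)
    (fun i => by ring)
  have h2 : ∑ i, ∑ j, (x i * y j - x j * y i) ^ 2 =
      2 * (inner ℝ x x * inner ℝ y y - inner ℝ x y ^ 2) := by
    have e : ∀ i j, (x i * y j - x j * y i) ^ 2 =
        (x i * x i) * (y j * y j) + (y i * y i) * (x j * x j)
          - 2 * ((x i * y i) * (x j * y j)) := fun i j => by ring
    simp only [e, Finset.sum_sub_distrib, Finset.sum_add_distrib, ← Finset.mul_sum,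
      ← Finset.sum_mul, euclidean_inner_eq_sum]
    ring
  linarith

/-- The orthogonal group acts transitively on the pairs of vectors with given Gram matrix: a
reflection takes `x` to `x'`, and a second one, which fixes `x'`, adjusts the other vector. -/
lemma exists_isometry_of_gram_eq {E : Type*} [NormedAddCommGroup E] [InnerProductSpace ℝ E]
    [FiniteDimensional ℝ E] (x y x' y' : E) (hxx : inner ℝ x x = inner ℝ x' x')
    (hxy : inner ℝ x y = inner ℝ x' y') (hyy : inner ℝ y y = inner ℝ y' y') :
    ∃ T : E ≃ₗᵢ[ℝ] E, T x = x' ∧ T y = y' := by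
  have hnx : ‖x‖ = ‖x'‖ := by
    rw [norm_eq_sqrt_real_inner, norm_eq_sqrt_real_inner, hxx]
  have hny : ‖y‖ = ‖y'‖ := by
    rw [norm_eq_sqrt_real_inner, norm_eq_sqrt_real_inner, hyy]
  set ρ := (ℝ ∙ (x - x'))ᗮ.reflection with hρ
  have h1 : ρ x = x' := Submodule.reflection_sub hnx
  have h2 : (ℝ ∙ (ρ y - y'))ᗮ.reflection (ρ y) = y' :=
    Submodule.reflection_sub (by rw [ρ.norm_map, hny])
  have h3 : (ℝ ∙ (ρ y - y'))ᗮ.reflection x' = x' := by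
    apply Submodule.reflection_mem_subspace_eq_self
    rw [Submodule.mem_orthogonal_singleton_iff_inner_right, real_inner_comm, inner_sub_right,
      ← hxy, ← ρ.inner_map_map x y, h1, sub_self]
  exact ⟨ρ.trans (ℝ ∙ (ρ y - y'))ᗮ.reflection, by simp [h1, h3], by simp [h2]⟩

lemma exists_orthogonal_of_gram_eq {k : ℕ} (x y x' y' : EuclideanSpace ℝ (Fin k))
    (hxx : inner ℝ x x = inner ℝ x' x')
    (hxy : inner ℝ x y = inner ℝ x' y') (hyy : inner ℝ y y = inner ℝ y' y') :
    ∃ A : Matrix.orthogonalGroup (Fin k) ℝ,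
      (A : Matrix (Fin k) (Fin k) ℝ).mulVec x.ofLp = x'.ofLp ∧
      (A : Matrix (Fin k) (Fin k) ℝ).mulVec y.ofLp = y'.ofLp := by
  obtain ⟨T, hTx, hTy⟩ := exists_isometry_of_gram_eq x y x' y' hxx hxy hyy
  have key : ∀ v : EuclideanSpace ℝ (Fin k),
      (LinearMap.toMatrix (EuclideanSpace.basisFun (Fin k) ℝ).toBasis
        (EuclideanSpace.basisFun (Fin k) ℝ).toBasis
        (T.toLinearEquiv : EuclideanSpace ℝ (Fin k) →ₗ[ℝ] EuclideanSpace ℝ (Fin k))).mulVec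
        v.ofLp = (T v).ofLp := by
    intro v
    have := LinearMap.toMatrix_mulVec_repr (EuclideanSpace.basisFun (Fin k) ℝ).toBasis
        (EuclideanSpace.basisFun (Fin k) ℝ).toBasis
        (T.toLinearEquiv : EuclideanSpace ℝ (Fin k) →ₗ[ℝ] EuclideanSpace ℝ (Fin k)) v
    have hrepr : ∀ w : EuclideanSpace ℝ (Fin k),
        ⇑((EuclideanSpace.basisFun (Fin k) ℝ).toBasis.repr w) = w.ofLp := fun w => by
      ext i
      simp
    rw [hrepr, hrepr] at this
    exact this
  refine ⟨⟨_, T.toMatrix_mem_unitaryGroup (EuclideanSpace.basisFun (Fin k) ℝ)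
    (EuclideanSpace.basisFun (Fin k) ℝ)⟩, ?_, ?_⟩
  · rw [← hTx]; exact key x
  · rw [← hTy]; exact key y

end Pairs

/-! ### Blocks, the action and the momentum mapping -/

section Blocks

variable {ℓ : ℕ} {m : Fin (ℓ + 1) → ℕ}

lemma inner_eq_sum_proj (x y : EuclideanSpace ℝ (Idx m)) :
    inner ℝ x y = ∑ σ, inner ℝ (proj σ x) (proj σ y) := by
  simp only [euclidean_inner_eq_sum, Fintype.sum_sigma]
  rfl

lemma ext_proj {x y : EuclideanSpace ℝ (Idx m)} (h : ∀ σ, proj σ x = proj σ y) : x = y := by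
  ext ⟨σ, i⟩
  exact congrArg (fun v : EuclideanSpace ℝ (Fin (m σ)) => v i) (h σ)

lemma proj_rot (g : SymGroup m) (σ : Fin (ℓ + 1)) (x : EuclideanSpace ℝ (Idx m)) :
    proj σ (rot g x) =
      WithLp.toLp 2 ((g σ : Matrix (Fin (m σ)) (Fin (m σ)) ℝ).mulVec (proj σ x).ofLp) := rfl

lemma inner_orthogonal {k : ℕ} (A : Matrix.orthogonalGroup (Fin k) ℝ) (v w : Fin k → ℝ) :
    inner ℝ (WithLp.toLp 2 ((A : Matrix (Fin k) (Fin k) ℝ).mulVec v))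
      (WithLp.toLp 2 ((A : Matrix (Fin k) (Fin k) ℝ).mulVec w)) =
      inner ℝ (WithLp.toLp 2 v : EuclideanSpace ℝ (Fin k)) (WithLp.toLp 2 w) := by
  have h : (A : Matrix (Fin k) (Fin k) ℝ).transpose * (A : Matrix (Fin k) (Fin k) ℝ) = 1 :=
    (Matrix.mem_orthogonalGroup_iff' (Fin k) ℝ).mp A.2
  simp only [EuclideanSpace.inner_eq_star_dotProduct, star_trivial]
  rw [Matrix.dotProduct_mulVec, Matrix.vecMul_mulVec, h, Matrix.vecMul_one]

lemma inner_proj_rot (g : SymGroup m) (σ : Fin (ℓ + 1)) (x y : EuclideanSpace ℝ (Idx m)) :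
    inner ℝ (proj σ (rot g x)) (proj σ (rot g y)) = inner ℝ (proj σ x) (proj σ y) := by
  rw [proj_rot, proj_rot, inner_orthogonal]

lemma momentumMap_apply (p : Phase (Idx m)) (σ : Fin (ℓ + 1)) (i k : Fin (m σ)) :
    (momentumMap p σ).1 i k =
      proj σ p.1 i * proj σ p.2 k - proj σ p.1 k * proj σ p.2 i := rfl

lemma momentumMap_eq_vecMulVec (p : Phase (Idx m)) (σ : Fin (ℓ + 1)) :
    (momentumMap p σ).1 = Matrix.vecMulVec (proj σ p.1).ofLp (proj σ p.2).ofLp -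
      Matrix.vecMulVec (proj σ p.2).ofLp (proj σ p.1).ofLp := by
  ext i k
  rw [momentumMap_apply]
  simp [Matrix.vecMulVec_apply, mul_comm]

/-- Equivariance of the momentum mapping. -/
lemma momentumMap_act (g : SymGroup m) (p : Phase (Idx m)) (σ : Fin (ℓ + 1)) :
    (momentumMap (act g p) σ).1 = (g σ : Matrix (Fin (m σ)) (Fin (m σ)) ℝ) *
      (momentumMap p σ).1 * ((g σ)⁻¹ : Matrix.orthogonalGroup (Fin (m σ)) ℝ) := by
  have hinv : (((g σ)⁻¹ : Matrix.orthogonalGroup (Fin (m σ)) ℝ) :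
      Matrix (Fin (m σ)) (Fin (m σ)) ℝ) =
      (g σ : Matrix (Fin (m σ)) (Fin (m σ)) ℝ).transpose := rfl
  rw [momentumMap_eq_vecMulVec, momentumMap_eq_vecMulVec, hinv]
  simp only [act, proj_rot, mul_sub, sub_mul, Matrix.mul_vecMulVec, Matrix.vecMulVec_mul,
    Matrix.vecMul_transpose]

lemma mem_isotropy_iff {g : SymGroup m} {μ : Momentum m} {p : Phase (Idx m)}
    (hp : momentumMap p = μ) : g ∈ isotropy μ ↔ momentumMap (act g p) = μ := by
  subst hp
  constructor
  · intro h
    funext σ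
    apply Subtype.ext
    rw [momentumMap_act]
    exact h σ
  · intro h σ
    rw [← momentumMap_act, h]

lemma casimir_momentumMap (p : Phase (Idx m)) (σ : Fin (ℓ + 1)) :
    casimir (momentumMap p) σ = inner ℝ (proj σ p.1) (proj σ p.1) *
      inner ℝ (proj σ p.2) (proj σ p.2) - inner ℝ (proj σ p.1) (proj σ p.2) ^ 2 := by
  rw [← sum_wedge_sq]
  rfl

lemma casimir_eq_zero (μ : Momentum m) {σ : Fin (ℓ + 1)} (h : m σ = 1) : casimir μ σ = 0 := by
  unfold casimir
  refine Finset.sum_eq_zero fun i _ => Finset.sum_eq_zero fun k hk => ?_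
  have h1 := i.2
  have h2 := k.2
  have h3 : i < k := Finset.mem_Ioi.mp hk
  omega

/-- `so(1)` is trivial. -/
lemma momentum_eq_of_eq_one {σ : Fin (ℓ + 1)} (h : m σ = 1)
    (A B : LieAlgebra.Orthogonal.so (Fin (m σ)) ℝ) : A = B := by
  have hz : ∀ C : LieAlgebra.Orthogonal.so (Fin (m σ)) ℝ, ∀ i k, C.1 i k = 0 := by
    intro C i k
    have hik : i = k := Fin.ext (by have := i.2; have := k.2; omega)
    subst hik
    have h1 := congrFun (congrFun ((LieAlgebra.Orthogonal.mem_so _ _ _).mp C.2) i) i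
    simp only [Matrix.transpose_apply, Matrix.neg_apply] at h1
    linarith
  apply Subtype.ext
  ext i k
  rw [hz, hz]

lemma proj_fst_ne_zero {p : Phase (Idx m)} {σ : Fin (ℓ + 1)} (h : momentumMap p σ ≠ 0) :
    proj σ p.1 ≠ 0 := by
  intro h0
  apply h
  apply Subtype.ext
  ext i k
  rw [momentumMap_apply, h0]
  simp

end Blocks

/-! ### Algebraic properties of the reduction mapping -/

section Reduction

variable {ℓ : ℕ} {m : Fin (ℓ + 1) → ℕ}

lemma reduction_fst_of_eq_one (p : Phase (Idx m)) {σ : Fin (ℓ + 1)} (h : m σ = 1) :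
    (reduction p).1 σ = proj σ p.1 ⟨0, by omega⟩ := by
  simp [reduction, h, proj]

lemma reduction_snd_of_eq_one (p : Phase (Idx m)) {σ : Fin (ℓ + 1)} (h : m σ = 1) :
    (reduction p).2 σ = proj σ p.2 ⟨0, by omega⟩ := by
  simp [reduction, h, proj]

lemma reduction_fst_of_ne_one (p : Phase (Idx m)) {σ : Fin (ℓ + 1)} (h : m σ ≠ 1) :
    (reduction p).1 σ = ‖proj σ p.1‖ := by
  simp [reduction, h]

lemma reduction_snd_of_ne_one (p : Phase (Idx m)) {σ : Fin (ℓ + 1)} (h : m σ ≠ 1) :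
    (reduction p).2 σ = inner ℝ (proj σ p.1) (proj σ p.2) / ‖proj σ p.1‖ := by
  simp [reduction, h]

lemma reduction_fst_mul_fst (p : Phase (Idx m)) (σ : Fin (ℓ + 1)) :
    (reduction p).1 σ * (reduction p).1 σ = inner ℝ (proj σ p.1) (proj σ p.1) := by
  by_cases h : m σ = 1
  · rw [reduction_fst_of_eq_one p h, euclidean_inner_eq_sum, sum_fin_of_eq_one h]
  · rw [reduction_fst_of_ne_one p h, real_inner_self_eq_norm_mul_norm]

/-- If `m_σ ≠ 1` and `P_σ x = 0`, then both sides vanish. -/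
lemma reduction_fst_mul_snd (p : Phase (Idx m)) (σ : Fin (ℓ + 1)) :
    (reduction p).1 σ * (reduction p).2 σ = inner ℝ (proj σ p.1) (proj σ p.2) := by
  by_cases h : m σ = 1
  · rw [reduction_fst_of_eq_one p h, reduction_snd_of_eq_one p h, euclidean_inner_eq_sum,
      sum_fin_of_eq_one h]
  · rw [reduction_fst_of_ne_one p h, reduction_snd_of_ne_one p h]
    by_cases h0 : proj σ p.1 = 0
    · simp [h0]
    · exact mul_div_cancel₀ _ (norm_ne_zero_iff.mpr h0)

lemma C₁_reduction (p : Phase (Idx m)) : C₁ (reduction p) = C₁ p := by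
  simp only [C₁, inner_eq_sum_proj, ← reduction_fst_mul_fst]
  rw [euclidean_inner_eq_sum]

lemma C₂_reduction (p : Phase (Idx m)) : C₂ (reduction p) = C₂ p := by
  simp only [C₂, inner_eq_sum_proj, ← reduction_fst_mul_snd]
  rw [euclidean_inner_eq_sum]

lemma reduction_mem_cotangentSphere {p : Phase (Idx m)} (hp : p ∈ cotangentSphere (Idx m)) :
    reduction p ∈ cotangentSphere (Fin (ℓ + 1)) :=
  ⟨(C₁_reduction p).trans hp.1, (C₂_reduction p).trans hp.2⟩

lemma reduction_fst_pos {p : Phase (Idx m)} {σ : Fin (ℓ + 1)} (h : m σ ≠ 1)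
    (h0 : proj σ p.1 ≠ 0) : 0 < (reduction p).1 σ := by
  rw [reduction_fst_of_ne_one p h]
  exact norm_pos_iff.mpr h0

/-- The kinetic energy of a block: its radial part and the centrifugal term. -/
lemma inner_proj_snd_eq (p : Phase (Idx m)) (σ : Fin (ℓ + 1))
    (h0 : m σ ≠ 1 → proj σ p.1 ≠ 0) :
    inner ℝ (proj σ p.2) (proj σ p.2) =
      (reduction p).2 σ ^ 2 + casimir (momentumMap p) σ / (reduction p).1 σ ^ 2 := by
  by_cases h : m σ = 1
  · rw [casimir_eq_zero _ h, zero_div, add_zero, reduction_snd_of_eq_one p h,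
      euclidean_inner_eq_sum, sum_fin_of_eq_one h, sq]
  · have hpos := reduction_fst_pos h (h0 h)
    rw [casimir_momentumMap, ← reduction_fst_mul_fst, ← reduction_fst_mul_snd]
    field_simp
    ring

lemma neumannHamiltonian_eq_rosochatius (b : Fin (ℓ + 1) → ℝ) (p : Phase (Idx m))
    (h0 : ∀ σ, m σ ≠ 1 → proj σ p.1 ≠ 0) :
    neumannHamiltonian b p =
      rosochatiusHamiltonian b (casimir (momentumMap p)) (reduction p) := by
  have h1 : ∀ σ, ∑ i : Fin (m σ), p.1 ⟨σ, i⟩ ^ 2 = (reduction p).1 σ ^ 2 := by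
    intro σ
    rw [sq, reduction_fst_mul_fst, euclidean_inner_eq_sum]
    exact Finset.sum_congr rfl fun i _ => sq _
  simp only [neumannHamiltonian, rosochatiusHamiltonian, h1]
  rw [inner_eq_sum_proj, ← mul_add, ← Finset.sum_add_distrib]
  congr 1
  refine Finset.sum_congr rfl fun σ _ => ?_
  rw [inner_proj_snd_eq p σ (h0 σ)]
  ring

lemma reduction_act_of_ne_one (g : SymGroup m) (p : Phase (Idx m)) {σ : Fin (ℓ + 1)}
    (h : m σ ≠ 1) :
    (reduction (act g p)).1 σ = (reduction p).1 σ ∧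
      (reduction (act g p)).2 σ = (reduction p).2 σ := by
  have hn : ‖proj σ (act g p).1‖ = ‖proj σ p.1‖ := by
    rw [norm_eq_sqrt_real_inner, norm_eq_sqrt_real_inner]
    congr 1
    exact inner_proj_rot g σ p.1 p.1
  refine ⟨?_, ?_⟩
  · rw [reduction_fst_of_ne_one _ h, reduction_fst_of_ne_one _ h, hn]
  · rw [reduction_snd_of_ne_one _ h, reduction_snd_of_ne_one _ h, hn]
    congr 1
    exact inner_proj_rot g σ p.1 p.2

/-- A factor `O(1)` of `G` acts by a sign. -/
lemma exists_sign_reduction_act (g : SymGroup m) (p : Phase (Idx m)) {σ : Fin (ℓ + 1)}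
    (h : m σ = 1) :
    ∃ ε : ℝ, (ε = 1 ∨ ε = -1) ∧ (reduction (act g p)).1 σ = ε * (reduction p).1 σ ∧
      (reduction (act g p)).2 σ = ε * (reduction p).2 σ := by
  refine ⟨(g σ : Matrix (Fin (m σ)) (Fin (m σ)) ℝ) ⟨0, by omega⟩ ⟨0, by omega⟩, ?_, ?_, ?_⟩
  · have h1 := congrFun (congrFun ((Matrix.mem_orthogonalGroup_iff _ ℝ).mp (g σ).2)
      ⟨0, by omega⟩) ⟨0, by omega⟩
    rw [Matrix.mul_apply, sum_fin_of_eq_one h] at h1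
    rw [Matrix.one_apply_eq] at h1
    exact mul_self_eq_one_iff.mp h1
  · rw [reduction_fst_of_eq_one _ h, reduction_fst_of_eq_one _ h, act, proj_rot]
    exact sum_fin_of_eq_one h _
  · rw [reduction_snd_of_eq_one _ h, reduction_snd_of_eq_one _ h, act, proj_rot]
    exact sum_fin_of_eq_one h _

/-- Two points with the same momentum whose reductions agree in the block `σ` up to a sign
`ε`, `ε = 1` if `m_σ ≠ 1`, are related in this block by an orthogonal matrix: their components
have the same Gram matrix by `inner_proj_snd_eq`. -/
lemma exists_orthogonal_block {p q : Phase (Idx m)} (σ : Fin (ℓ + 1)) {ε : ℝ}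
    (hp0 : m σ ≠ 1 → proj σ p.1 ≠ 0) (hq0 : m σ ≠ 1 → proj σ q.1 ≠ 0)
    (hpq : momentumMap p = momentumMap q) (hε : ε = 1 ∨ ε = -1)
    (h1 : (reduction q).1 σ = ε * (reduction p).1 σ)
    (h2 : (reduction q).2 σ = ε * (reduction p).2 σ) :
    ∃ A : Matrix.orthogonalGroup (Fin (m σ)) ℝ,
      (A : Matrix (Fin (m σ)) (Fin (m σ)) ℝ).mulVec (proj σ p.1).ofLp = (proj σ q.1).ofLp ∧
      (A : Matrix (Fin (m σ)) (Fin (m σ)) ℝ).mulVec (proj σ p.2).ofLp = (proj σ q.2).ofLp ∧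
      (m σ = 1 → ε = 1 → A = 1) := by
  have hsq : ε * ε = 1 := by rcases hε with h | h <;> simp [h]
  by_cases hc : m σ = 1 ∧ ε = 1
  · obtain ⟨h, hε1⟩ := hc
    have hidx : ∀ i : Fin (m σ), i = ⟨0, by omega⟩ := fun i =>
      Fin.ext (by have := i.2; simp; omega)
    rw [hε1, one_mul, reduction_fst_of_eq_one _ h, reduction_fst_of_eq_one _ h] at h1
    rw [hε1, one_mul, reduction_snd_of_eq_one _ h, reduction_snd_of_eq_one _ h] at h2
    refine ⟨1, ?_, ?_, fun _ _ => rfl⟩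
    · rw [Submonoid.coe_one, Matrix.one_mulVec]
      funext i
      rw [hidx i]
      exact h1.symm
    · rw [Submonoid.coe_one, Matrix.one_mulVec]
      funext i
      rw [hidx i]
      exact h2.symm
  · obtain ⟨A, hA1, hA2⟩ := exists_orthogonal_of_gram_eq (proj σ p.1) (proj σ p.2)
      (proj σ q.1) (proj σ q.2)
      (by rw [← reduction_fst_mul_fst, ← reduction_fst_mul_fst, h1]
          linear_combination (-(reduction p).1 σ * (reduction p).1 σ) * hsq)
      (by rw [← reduction_fst_mul_snd, ← reduction_fst_mul_snd, h1, h2]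
          linear_combination (-(reduction p).1 σ * (reduction p).2 σ) * hsq)
      (by rw [inner_proj_snd_eq p σ hp0, inner_proj_snd_eq q σ hq0, hpq, h1, h2, mul_pow,
            mul_pow, sq ε, hsq, one_mul, one_mul])
    exact ⟨A, hA1, hA2, fun h hε1 => absurd ⟨h, hε1⟩ hc⟩

/-- The blockwise orthogonal matrices form an element of `G`, which fixes `μ` because it maps one
point of momentum `μ` to another; it lies in the product of the `O(m_σ)` with `m_σ ≥ 2` if all
signs are `1`. -/
lemma exists_act_eq {μ : Momentum m} {p q : Phase (Idx m)}
    (hp : momentumMap p = μ) (hq : momentumMap q = μ)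
    (hp0 : ∀ σ, m σ ≠ 1 → proj σ p.1 ≠ 0) (hq0 : ∀ σ, m σ ≠ 1 → proj σ q.1 ≠ 0)
    {ε : Fin (ℓ + 1) → ℝ} (hε : ∀ σ, ε σ = 1 ∨ ε σ = -1)
    (h : reduction q = scaleBy ε (reduction p)) :
    ∃ g ∈ isotropy μ, act g p = q ∧ ∀ σ, m σ = 1 → ε σ = 1 → g σ = 1 := by
  choose g hg1 hg2 hg3 using fun σ =>
    exists_orthogonal_block σ (hp0 σ) (hq0 σ) (hp.trans hq.symm) (hε σ)
      (by rw [h]; rfl) (by rw [h]; rfl)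
  have hact : act g p = q := by
    refine Prod.ext (ext_proj fun σ => ?_) (ext_proj fun σ => ?_)
    · rw [act, proj_rot, hg1]
    · rw [act, proj_rot, hg2]
  exact ⟨g, (mem_isotropy_iff hp).mpr (by rw [hact, hq]), hact, hg3⟩

end Reduction

/-! ### The derivative of the reduction mapping -/

section Derivative

variable {E : Type*} [NormedAddCommGroup E] [InnerProductSpace ℝ E]

lemma hasDerivAt_affine_line (a b : ℝ) : HasDerivAt (fun t : ℝ => a + t * b) b 0 := by
  simpa using ((hasDerivAt_id (0 : ℝ)).mul_const b).const_add a

lemma hasDerivAt_norm_line {x : E} (hx : x ≠ 0) (a : E) :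
    HasDerivAt (fun t : ℝ => ‖x + t • a‖) (inner ℝ x a / ‖x‖) 0 := by
  have hl : HasDerivAt (fun t : ℝ => x + t • a) a 0 := by
    simpa using ((hasDerivAt_id (0 : ℝ)).smul_const a).const_add x
  have h := hl.norm_sq.sqrt (by simpa using hx)
  have hn : ‖x‖ ≠ 0 := norm_ne_zero_iff.mpr hx
  convert h using 1
  · funext t
    rw [Real.sqrt_sq (norm_nonneg _)]
  · simp only [zero_smul, add_zero]
    rw [Real.sqrt_sq (norm_nonneg _)]
    field_simp

lemma hasDerivAt_inner_div_norm_line {x : E} (hx : x ≠ 0) (y a b : E) :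
    HasDerivAt (fun t : ℝ => inner ℝ (x + t • a) (y + t • b) / ‖x + t • a‖)
      ((inner ℝ a y + inner ℝ x b) / ‖x‖ - inner ℝ x y * inner ℝ x a / ‖x‖ ^ 3) 0 := by
  have hl : ∀ u c : E, HasDerivAt (fun t : ℝ => u + t • c) c 0 := fun u c => by
    simpa using ((hasDerivAt_id (0 : ℝ)).smul_const c).const_add u
  have hn : ‖x‖ ≠ 0 := norm_ne_zero_iff.mpr hx
  have h := ((hl x a).inner ℝ (hl y b)).div (hasDerivAt_norm_line hx a) (by simpa using hx)
  refine HasDerivAt.congr_deriv h ?_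
  simp only [zero_smul, add_zero]
  field_simp
  ring

variable {ℓ : ℕ} {m : Fin (ℓ + 1) → ℕ}

lemma contDiff_proj (σ : Fin (ℓ + 1)) :
    ContDiff ℝ ∞ (proj σ : EuclideanSpace ℝ (Idx m) → EuclideanSpace ℝ (Fin (m σ))) := by
  rw [contDiff_euclidean]
  intro i
  simp only [proj]
  fun_prop

lemma contDiffAt_reduction {p : Phase (Idx m)} (h0 : ∀ σ, m σ ≠ 1 → proj σ p.1 ≠ 0) :
    ContDiffAt ℝ ∞ reduction p := by
  have hx : ∀ σ, ContDiffAt ℝ ∞ (fun p : Phase (Idx m) => proj σ p.1) p := fun σ =>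
    ((contDiff_proj σ).comp contDiff_fst).contDiffAt
  have hy : ∀ σ, ContDiffAt ℝ ∞ (fun p : Phase (Idx m) => proj σ p.2) p := fun σ =>
    ((contDiff_proj σ).comp contDiff_snd).contDiffAt
  refine ContDiffAt.prodMk (f := fun p => (reduction p).1) (g := fun p => (reduction p).2) ?_ ?_
  · rw [contDiffAt_euclidean]
    intro σ
    by_cases h : m σ = 1
    · simp only [reduction_fst_of_eq_one _ h]
      exact contDiffAt_euclidean.mp (hx σ) _
    · simp only [reduction_fst_of_ne_one _ h]
      exact (hx σ).norm ℝ (h0 σ h)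
  · rw [contDiffAt_euclidean]
    intro σ
    by_cases h : m σ = 1
    · simp only [reduction_snd_of_eq_one _ h]
      exact contDiffAt_euclidean.mp (hy σ) _
    · simp only [reduction_snd_of_ne_one _ h]
      exact ((hx σ).inner ℝ (hy σ)).div ((hx σ).norm ℝ (h0 σ h))
        (norm_ne_zero_iff.mpr (h0 σ h))

lemma hasFDerivAt_reduction {p : Phase (Idx m)} (h0 : ∀ σ, m σ ≠ 1 → proj σ p.1 ≠ 0) :
    HasFDerivAt reduction (fderiv ℝ reduction p) p :=
  ((contDiffAt_reduction h0).differentiableAt (by simp)).hasFDerivAt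

lemma hasDerivAt_reduction_line_fst {p : Phase (Idx m)}
    (h0 : ∀ σ, m σ ≠ 1 → proj σ p.1 ≠ 0) (v : Phase (Idx m)) (σ : Fin (ℓ + 1)) :
    HasDerivAt (fun t : ℝ => (reduction (p + t • v)).1 σ) ((fderiv ℝ reduction p v).1 σ) 0 :=
  ((EuclideanSpace.proj σ).comp (ContinuousLinearMap.fst ℝ (EuclideanSpace ℝ (Fin (ℓ + 1)))
    (EuclideanSpace ℝ (Fin (ℓ + 1))))).hasFDerivAt.comp_hasDerivAt (0 : ℝ)
    ((hasFDerivAt_reduction h0).hasLineDerivAt v)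

lemma hasDerivAt_reduction_line_snd {p : Phase (Idx m)}
    (h0 : ∀ σ, m σ ≠ 1 → proj σ p.1 ≠ 0) (v : Phase (Idx m)) (σ : Fin (ℓ + 1)) :
    HasDerivAt (fun t : ℝ => (reduction (p + t • v)).2 σ) ((fderiv ℝ reduction p v).2 σ) 0 :=
  ((EuclideanSpace.proj σ).comp (ContinuousLinearMap.snd ℝ (EuclideanSpace ℝ (Fin (ℓ + 1)))
    (EuclideanSpace ℝ (Fin (ℓ + 1))))).hasFDerivAt.comp_hasDerivAt (0 : ℝ)
    ((hasFDerivAt_reduction h0).hasLineDerivAt v)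

lemma fderiv_reduction_fst_of_eq_one {p : Phase (Idx m)}
    (h0 : ∀ σ, m σ ≠ 1 → proj σ p.1 ≠ 0) (v : Phase (Idx m)) {σ : Fin (ℓ + 1)} (h : m σ = 1) :
    (fderiv ℝ reduction p v).1 σ = proj σ v.1 ⟨0, by omega⟩ := by
  refine (hasDerivAt_reduction_line_fst h0 v σ).unique ?_
  simp only [reduction_fst_of_eq_one _ h]
  exact hasDerivAt_affine_line (proj σ p.1 ⟨0, by omega⟩) (proj σ v.1 ⟨0, by omega⟩)

lemma fderiv_reduction_snd_of_eq_one {p : Phase (Idx m)}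
    (h0 : ∀ σ, m σ ≠ 1 → proj σ p.1 ≠ 0) (v : Phase (Idx m)) {σ : Fin (ℓ + 1)} (h : m σ = 1) :
    (fderiv ℝ reduction p v).2 σ = proj σ v.2 ⟨0, by omega⟩ := by
  refine (hasDerivAt_reduction_line_snd h0 v σ).unique ?_
  simp only [reduction_snd_of_eq_one _ h]
  exact hasDerivAt_affine_line (proj σ p.2 ⟨0, by omega⟩) (proj σ v.2 ⟨0, by omega⟩)

lemma fderiv_reduction_fst_of_ne_one {p : Phase (Idx m)}
    (h0 : ∀ σ, m σ ≠ 1 → proj σ p.1 ≠ 0) (v : Phase (Idx m)) {σ : Fin (ℓ + 1)} (h : m σ ≠ 1) :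
    (fderiv ℝ reduction p v).1 σ = inner ℝ (proj σ p.1) (proj σ v.1) / ‖proj σ p.1‖ := by
  refine (hasDerivAt_reduction_line_fst h0 v σ).unique ?_
  simp only [reduction_fst_of_ne_one _ h]
  exact hasDerivAt_norm_line (h0 σ h) (proj σ v.1)

lemma fderiv_reduction_snd_of_ne_one {p : Phase (Idx m)}
    (h0 : ∀ σ, m σ ≠ 1 → proj σ p.1 ≠ 0) (v : Phase (Idx m)) {σ : Fin (ℓ + 1)} (h : m σ ≠ 1) :
    (fderiv ℝ reduction p v).2 σ =
      (inner ℝ (proj σ v.1) (proj σ p.2) + inner ℝ (proj σ p.1) (proj σ v.2)) / ‖proj σ p.1‖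
        - inner ℝ (proj σ p.1) (proj σ p.2) * inner ℝ (proj σ p.1) (proj σ v.1)
          / ‖proj σ p.1‖ ^ 3 := by
  refine (hasDerivAt_reduction_line_snd h0 v σ).unique ?_
  simp only [reduction_snd_of_ne_one _ h]
  exact hasDerivAt_inner_div_norm_line (h0 σ h) (proj σ p.2) (proj σ v.1) (proj σ v.2)

end Derivative

/-! ### The reduction mapping is Poisson -/

section Poisson

variable {ℓ : ℕ} {m : Fin (ℓ + 1) → ℕ}

lemma proj_single_self (σ : Fin (ℓ + 1)) (i : Fin (m σ)) :
    proj σ (EuclideanSpace.single (⟨σ, i⟩ : Idx m) (1 : ℝ)) = EuclideanSpace.single i 1 := by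
  ext k
  simp [proj]

lemma proj_single_of_ne {τ : Fin (ℓ + 1)} {s : Idx m} (h : τ ≠ s.1) :
    proj τ (EuclideanSpace.single s (1 : ℝ)) = 0 := by
  ext k
  have : (⟨τ, k⟩ : Idx m) ≠ s := fun e => h (by rw [← e])
  simp [proj, this]

lemma proj_zero (σ : Fin (ℓ + 1)) : proj σ (0 : EuclideanSpace ℝ (Idx m)) = 0 := rfl

lemma fderiv_reduction_apply_of_proj_eq_zero {p : Phase (Idx m)}
    (h0 : ∀ σ, m σ ≠ 1 → proj σ p.1 ≠ 0) {v : Phase (Idx m)} {σ : Fin (ℓ + 1)}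
    (h1 : proj σ v.1 = 0) (h2 : proj σ v.2 = 0) :
    (fderiv ℝ reduction p v).1 σ = 0 ∧ (fderiv ℝ reduction p v).2 σ = 0 := by
  by_cases h : m σ = 1
  · rw [fderiv_reduction_fst_of_eq_one h0 v h, fderiv_reduction_snd_of_eq_one h0 v h, h1, h2]
    simp
  · rw [fderiv_reduction_fst_of_ne_one h0 v h, fderiv_reduction_snd_of_ne_one h0 v h, h1, h2]
    simp

/-- The derivative of the reduction mapping maps `∂/∂x_s` to `α_s ∂/∂ξ_σ + β_s ∂/∂η_σ` and
`∂/∂y_s` to `α_s ∂/∂η_σ`, where `s` lies in block `σ` and `(α_s)` is a unit vector in every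
block. -/
lemma exists_fderiv_reduction_single {p : Phase (Idx m)}
    (h0 : ∀ σ, m σ ≠ 1 → proj σ p.1 ≠ 0) :
    ∃ α β : Idx m → ℝ, (∀ σ, ∑ i, α ⟨σ, i⟩ * α ⟨σ, i⟩ = 1) ∧
      (∀ s, fderiv ℝ reduction p (EuclideanSpace.single s 1, 0) =
        α s • ((EuclideanSpace.single s.1 1, 0) : Phase (Fin (ℓ + 1))) +
          β s • ((0, EuclideanSpace.single s.1 1) : Phase (Fin (ℓ + 1)))) ∧
      ∀ s, fderiv ℝ reduction p (0, EuclideanSpace.single s 1) =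
        α s • ((0, EuclideanSpace.single s.1 1) : Phase (Fin (ℓ + 1))) := by
  obtain ⟨α, hα1, hα⟩ : ∃ α : Idx m → ℝ, (∀ s, m s.1 = 1 → α s = 1) ∧
      ∀ s, m s.1 ≠ 1 → α s = p.1 s / ‖proj s.1 p.1‖ :=
    ⟨fun s => if m s.1 = 1 then 1 else p.1 s / ‖proj s.1 p.1‖, fun _ h => if_pos h,
      fun _ h => if_neg h⟩
  obtain ⟨β, hβ1, hβ⟩ : ∃ β : Idx m → ℝ, (∀ s, m s.1 = 1 → β s = 0) ∧
      ∀ s, m s.1 ≠ 1 → β s = p.2 s / ‖proj s.1 p.1‖ -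
        inner ℝ (proj s.1 p.1) (proj s.1 p.2) * p.1 s / ‖proj s.1 p.1‖ ^ 3 :=
    ⟨fun s => if m s.1 = 1 then 0 else p.2 s / ‖proj s.1 p.1‖ -
        inner ℝ (proj s.1 p.1) (proj s.1 p.2) * p.1 s / ‖proj s.1 p.1‖ ^ 3, fun _ h => if_pos h,
      fun _ h => if_neg h⟩
  have happ : ∀ (x : EuclideanSpace ℝ (Idx m)) (σ : Fin (ℓ + 1)) (i : Fin (m σ)),
      (proj σ x).ofLp i = x ⟨σ, i⟩ := fun _ _ _ => rfl
  refine ⟨α, β, ?_, ?_, ?_⟩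
  · intro σ
    by_cases h : m σ = 1
    · rw [sum_fin_of_eq_one h, hα1 _ h, mul_one]
    · have hn : ‖proj σ p.1‖ ≠ 0 := norm_ne_zero_iff.mpr (h0 σ h)
      have hsum : ∑ i, α ⟨σ, i⟩ * α ⟨σ, i⟩ =
          (∑ i, proj σ p.1 i * proj σ p.1 i) / (‖proj σ p.1‖ * ‖proj σ p.1‖) := by
        rw [Finset.sum_div]
        refine Finset.sum_congr rfl fun i _ => ?_
        rw [hα _ h, div_mul_div_comm]
        rfl
      rw [hsum, ← euclidean_inner_eq_sum, real_inner_self_eq_norm_mul_norm,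
        div_self (mul_ne_zero hn hn)]
  all_goals
    rintro ⟨σ, i⟩
    refine Prod.ext ?_ ?_ <;> ext τ
    all_goals
      by_cases hτ : τ = σ
      · subst hτ
        by_cases h : m τ = 1
        · have hi : (⟨0, by omega⟩ : Fin (m τ)) = i := Fin.ext (by have := i.2; simp; omega)
          simp [fderiv_reduction_fst_of_eq_one h0 _ h, fderiv_reduction_snd_of_eq_one h0 _ h,
            hα1 ⟨τ, i⟩ h, hβ1 ⟨τ, i⟩ h, proj_single_self, proj_zero, hi]
        · simp [fderiv_reduction_fst_of_ne_one h0 _ h, fderiv_reduction_snd_of_ne_one h0 _ h,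
            hα ⟨τ, i⟩ h, hβ ⟨τ, i⟩ h, proj_single_self, proj_zero, happ,
            EuclideanSpace.inner_single_right, EuclideanSpace.inner_single_left]
      · have hz := proj_single_of_ne (s := (⟨σ, i⟩ : Idx m)) hτ
        first
          | rw [(fderiv_reduction_apply_of_proj_eq_zero h0 hz (proj_zero τ)).1]
          | rw [(fderiv_reduction_apply_of_proj_eq_zero h0 hz (proj_zero τ)).2]
          | rw [(fderiv_reduction_apply_of_proj_eq_zero h0 (proj_zero τ) hz).1]
          | rw [(fderiv_reduction_apply_of_proj_eq_zero h0 (proj_zero τ) hz).2]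
        simp [hτ]

lemma canonicalBracket_comp_reduction {p : Phase (Idx m)}
    (h0 : ∀ σ, m σ ≠ 1 → proj σ p.1 ≠ 0) {f g : Phase (Fin (ℓ + 1)) → ℝ}
    (hf : DifferentiableAt ℝ f (reduction p)) (hg : DifferentiableAt ℝ g (reduction p)) :
    canonicalBracket (fun p => f (reduction p)) (fun p => g (reduction p)) p =
      canonicalBracket f g (reduction p) := by
  obtain ⟨α, β, hα, hX, hY⟩ := exists_fderiv_reduction_single h0
  have hchain : ∀ {f : Phase (Fin (ℓ + 1)) → ℝ}, DifferentiableAt ℝ f (reduction p) → ∀ v,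
      fderiv ℝ (fun p => f (reduction p)) p v =
        fderiv ℝ f (reduction p) (fderiv ℝ reduction p v) := by
    intro f hf v
    exact congrArg (fun L => L v) (hf.hasFDerivAt.comp p (hasFDerivAt_reduction h0)).fderiv
  have hdX : ∀ {f : Phase (Fin (ℓ + 1)) → ℝ}, DifferentiableAt ℝ f (reduction p) → ∀ s,
      dX (fun p => f (reduction p)) s p =
        α s * dX f s.1 (reduction p) + β s * dY f s.1 (reduction p) := by
    intro f hf s
    rw [dX, hchain hf, hX, map_add, map_smul, map_smul]
    rfl
  have hdY : ∀ {f : Phase (Fin (ℓ + 1)) → ℝ}, DifferentiableAt ℝ f (reduction p) → ∀ s,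
      dY (fun p => f (reduction p)) s p = α s * dY f s.1 (reduction p) := by
    intro f hf s
    rw [dY, hchain hf, hY, map_smul]
    rfl
  simp only [canonicalBracket, hdX hf, hdX hg, hdY hf, hdY hg, Fintype.sum_sigma]
  refine Finset.sum_congr rfl fun σ _ => ?_
  rw [← one_mul (dX f σ (reduction p) * dY g σ (reduction p) -
    dY f σ (reduction p) * dX g σ (reduction p)), ← hα σ, Finset.sum_mul]
  exact Finset.sum_congr rfl fun i _ => by ring

lemma diracBracket_comp_reduction {p : Phase (Idx m)}
    (h0 : ∀ σ, m σ ≠ 1 → proj σ p.1 ≠ 0) {f g : Phase (Fin (ℓ + 1)) → ℝ}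
    (hf : DifferentiableAt ℝ f (reduction p)) (hg : DifferentiableAt ℝ g (reduction p)) :
    diracBracket (fun p => f (reduction p)) (fun p => g (reduction p)) p =
      diracBracket f g (reduction p) := by
  have hC₁ : DifferentiableAt ℝ (C₁ : Phase (Fin (ℓ + 1)) → ℝ) (reduction p) :=
    differentiableAt_fst.inner ℝ differentiableAt_fst
  have hC₂ : DifferentiableAt ℝ (C₂ : Phase (Fin (ℓ + 1)) → ℝ) (reduction p) :=
    differentiableAt_fst.inner ℝ differentiableAt_snd
  have e₁ : (C₁ : Phase (Idx m) → ℝ) = fun p => C₁ (reduction p) :=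
    funext fun p => (C₁_reduction p).symm
  have e₂ : (C₂ : Phase (Idx m) → ℝ) = fun p => C₂ (reduction p) :=
    funext fun p => (C₂_reduction p).symm
  unfold diracBracket
  rw [e₁, e₂, canonicalBracket_comp_reduction h0 hf hg, canonicalBracket_comp_reduction h0 hf hC₁,
    canonicalBracket_comp_reduction h0 hC₂ hg, canonicalBracket_comp_reduction h0 hf hC₂,
    canonicalBracket_comp_reduction h0 hC₁ hg]

end Poisson

/-! ### The symplectic form on vectors tangent to a momentum level -/

section Symplectic

variable {ℓ : ℕ} {m : Fin (ℓ + 1) → ℕ}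

/-- A vector tangent to a level of `J` is annihilated by the derivative of `J`. -/
lemma wedge_eq_zero_of_mem_tangentConeAt {μ : Momentum m} {p v : Phase (Idx m)}
    (hp : p ∈ momentumLevel μ) (hv : v ∈ tangentConeAt ℝ (momentumLevel μ) p)
    (σ : Fin (ℓ + 1)) (i k : Fin (m σ)) :
    proj σ v.1 i * proj σ p.2 k + proj σ p.1 i * proj σ v.2 k
      - (proj σ v.1 k * proj σ p.2 i + proj σ p.1 k * proj σ v.2 i) = 0 := by
  set φ : Phase (Idx m) → ℝ := fun p => p.1 ⟨σ, i⟩ * p.2 ⟨σ, k⟩ - p.1 ⟨σ, k⟩ * p.2 ⟨σ, i⟩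
    with hφ
  have hd : DifferentiableAt ℝ φ p := by
    rw [hφ]
    fun_prop
  have hconst : ∀ q ∈ momentumLevel μ, φ q = (μ σ).1 i k := by
    intro q hq
    rw [← hq.2]
    rfl
  have h1 : HasDerivAt (fun t : ℝ => φ (p + t • v)) (fderiv ℝ φ p v) 0 :=
    hd.hasFDerivAt.hasLineDerivAt v
  have hl := fun (w z : EuclideanSpace ℝ (Idx m)) (s : Idx m) =>
    hasDerivAt_affine_line (w s) (z s)
  have h2 := ((hl p.1 v.1 ⟨σ, i⟩).mul (hl p.2 v.2 ⟨σ, k⟩)).sub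
    ((hl p.1 v.1 ⟨σ, k⟩).mul (hl p.2 v.2 ⟨σ, i⟩))
  have h3 := h1.unique h2
  simp only [zero_mul, add_zero] at h3
  obtain ⟨α, L, hL, c, d, hd0, hds, hcd⟩ := exists_fun_of_mem_tangentConeAt hv
  have h4 := hd.hasFDerivAt.hasFDerivWithinAt.lim hd0 hds hcd
  have h5 : Filter.Tendsto (fun n => c n • (φ (p + d n) - φ p)) L (nhds 0) := by
    refine tendsto_const_nhds.congr' ?_
    filter_upwards [hds] with n hn
    rw [hconst _ hn, hconst _ hp, sub_self, smul_zero]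
  have h6 := tendsto_nhds_unique h4 h5
  rw [h6] at h3
  exact h3.symm

/-- Contraction of `a ∧ y + x ∧ b = 0` with `x` expresses `b` by `a`. -/
lemma inner_eq_of_wedge_eq_zero {k : ℕ} (x y a b c : EuclideanSpace ℝ (Fin k))
    (h : ∀ i j, a i * y j + x i * b j - (a j * y i + x j * b i) = 0) :
    inner ℝ x x * inner ℝ c b = inner ℝ x y * inner ℝ c a + inner ℝ x b * inner ℝ c x
      - inner ℝ x a * inner ℝ c y := by
  have h1 : ∑ i, ∑ j, x i * c j * (a i * y j + x i * b j - (a j * y i + x j * b i)) = 0 :=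
    Finset.sum_eq_zero fun i _ => Finset.sum_eq_zero fun j _ => by rw [h, mul_zero]
  have e : ∀ i j, x i * c j * (a i * y j + x i * b j - (a j * y i + x j * b i)) =
      (x i * a i) * (c j * y j) + (x i * x i) * (c j * b j) - (x i * y i) * (c j * a j)
        - (x i * b i) * (c j * x j) := fun i j => by ring
  simp only [e, Finset.sum_sub_distrib, Finset.sum_add_distrib, ← Finset.mul_sum,
    ← Finset.sum_mul] at h1
  simp only [euclidean_inner_eq_sum]
  linarith

lemma symplecticForm_fderiv_reduction {μ : Momentum m} {p v w : Phase (Idx m)}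
    (h0 : ∀ σ, m σ ≠ 1 → proj σ p.1 ≠ 0) (hp : p ∈ momentumLevel μ)
    (hv : v ∈ tangentConeAt ℝ (momentumLevel μ) p)
    (hw : w ∈ tangentConeAt ℝ (momentumLevel μ) p) :
    symplecticForm (fderiv ℝ reduction p v) (fderiv ℝ reduction p w) = symplecticForm v w := by
  unfold symplecticForm
  rw [inner_eq_sum_proj v.1, inner_eq_sum_proj w.1, euclidean_inner_eq_sum,
    euclidean_inner_eq_sum, ← Finset.sum_sub_distrib, ← Finset.sum_sub_distrib]
  refine Finset.sum_congr rfl fun σ _ => ?_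
  by_cases h : m σ = 1
  · rw [fderiv_reduction_fst_of_eq_one h0 v h, fderiv_reduction_snd_of_eq_one h0 v h,
      fderiv_reduction_fst_of_eq_one h0 w h, fderiv_reduction_snd_of_eq_one h0 w h,
      euclidean_inner_eq_sum, euclidean_inner_eq_sum, sum_fin_of_eq_one h, sum_fin_of_eq_one h]
  · rw [fderiv_reduction_fst_of_ne_one h0 v h, fderiv_reduction_snd_of_ne_one h0 v h,
      fderiv_reduction_fst_of_ne_one h0 w h, fderiv_reduction_snd_of_ne_one h0 w h]
    have hn : ‖proj σ p.1‖ ≠ 0 := norm_ne_zero_iff.mpr (h0 σ h)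
    have ev := inner_eq_of_wedge_eq_zero _ _ _ _ (proj σ w.1)
      (wedge_eq_zero_of_mem_tangentConeAt hp hv σ)
    have ew := inner_eq_of_wedge_eq_zero _ _ _ _ (proj σ v.1)
      (wedge_eq_zero_of_mem_tangentConeAt hp hw σ)
    rw [real_inner_self_eq_norm_mul_norm] at ev ew
    rw [real_inner_comm (proj σ v.1) (proj σ w.1), real_inner_comm (proj σ p.1) (proj σ w.1)] at ev
    rw [real_inner_comm (proj σ p.1) (proj σ v.1)] at ew
    apply mul_left_cancel₀ (mul_ne_zero hn hn)
    rw [mul_sub _ (inner ℝ (proj σ v.1) (proj σ w.2)), ev, ew]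
    field_simp
    ring

end Symplectic

/-! ### A smooth section of the reduction mapping -/

section Lift

variable {ℓ : ℕ} {m : Fin (ℓ + 1) → ℕ}

/-- The momentum `μ` is written as `μ_σ = e_σ ∧ f_σ` in every block, with a unit vector `e_σ`
and `f_σ ⊥ e_σ`; the vectors of a block with `m_σ = 1` are normalized to `e_σ = 1` and
`f_σ = 0`. -/
structure IsMomentumFrame (μ : Momentum m) (e f : ∀ σ, EuclideanSpace ℝ (Fin (m σ))) :
    Prop where
  inner_self : ∀ σ, inner ℝ (e σ) (e σ) = (1 : ℝ)
  inner_eq_zero : ∀ σ, inner ℝ (e σ) (f σ) = (0 : ℝ)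
  apply_of_eq_one : ∀ σ, m σ = 1 → ∀ i, e σ i = 1
  eq_zero_of_eq_one : ∀ σ, m σ = 1 → f σ = 0
  wedge : ∀ σ i k, (μ σ).1 i k = e σ i * f σ k - e σ k * f σ i

lemma exists_isMomentumFrame {μ : Momentum m} {p : Phase (Idx m)} (hp : momentumMap p = μ)
    (h0 : ∀ σ, m σ ≠ 1 → proj σ p.1 ≠ 0) : ∃ e f, IsMomentumFrame μ e f := by
  have key : ∀ σ, ∃ e f : EuclideanSpace ℝ (Fin (m σ)), inner ℝ e e = (1 : ℝ) ∧
      inner ℝ e f = (0 : ℝ) ∧ (m σ = 1 → ∀ i, e i = 1) ∧ (m σ = 1 → f = 0) ∧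
      ∀ i k, (μ σ).1 i k = e i * f k - e k * f i := by
    intro σ
    by_cases h : m σ = 1
    · refine ⟨WithLp.toLp 2 fun _ => 1, 0, ?_, by simp, fun _ _ => rfl, fun _ => rfl,
        fun i k => ?_⟩
      · rw [euclidean_inner_eq_sum, sum_fin_of_eq_one h, mul_one]
      · rw [momentum_eq_of_eq_one h (μ σ) 0]
        simp
    · -- Gram-Schmidt for the pair `P_σ x, P_σ y`, with the length of `P_σ x` moved to `f`
      have hn : ‖proj σ p.1‖ ≠ 0 := norm_ne_zero_iff.mpr (h0 σ h)
      refine ⟨‖proj σ p.1‖⁻¹ • proj σ p.1, ‖proj σ p.1‖ • (proj σ p.2 -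
        (inner ℝ (proj σ p.1) (proj σ p.2) / ‖proj σ p.1‖ ^ 2) • proj σ p.1), ?_, ?_,
        fun h1 => absurd h1 h, fun h1 => absurd h1 h, ?_⟩
      · rw [real_inner_smul_left, real_inner_smul_right, real_inner_self_eq_norm_mul_norm]
        field_simp
      · rw [real_inner_smul_left, real_inner_smul_right, inner_sub_right, real_inner_smul_right,
          real_inner_self_eq_norm_mul_norm]
        field_simp
        ring
      · intro i k
        rw [← hp, momentumMap_apply]
        simp only [PiLp.smul_apply, PiLp.sub_apply, smul_eq_mul]
        field_simp
        ring
  choose e f h1 h2 h3 h4 h5 using key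
  exact ⟨e, f, h1, h2, h3, h4, h5⟩

/-- The point over `(ξ, η)` with block components `x_σ = ξ_σ e_σ` and
`y_σ = η_σ e_σ + ξ_σ⁻¹ f_σ`. -/
noncomputable def frameLift (e f : ∀ σ, EuclideanSpace ℝ (Fin (m σ))) (q : Phase (Fin (ℓ + 1))) :
    Phase (Idx m) :=
  (WithLp.toLp 2 fun s => q.1 s.1 * e s.1 s.2,
   WithLp.toLp 2 fun s => q.2 s.1 * e s.1 s.2 + (q.1 s.1)⁻¹ * f s.1 s.2)

lemma proj_frameLift_fst (e f : ∀ σ, EuclideanSpace ℝ (Fin (m σ))) (q : Phase (Fin (ℓ + 1)))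
    (σ : Fin (ℓ + 1)) : proj σ (frameLift e f q).1 = q.1 σ • e σ := rfl

lemma proj_frameLift_snd (e f : ∀ σ, EuclideanSpace ℝ (Fin (m σ))) (q : Phase (Fin (ℓ + 1)))
    (σ : Fin (ℓ + 1)) : proj σ (frameLift e f q).2 = q.2 σ • e σ + (q.1 σ)⁻¹ • f σ := rfl

variable {μ : Momentum m} {e f : ∀ σ, EuclideanSpace ℝ (Fin (m σ))}

lemma IsMomentumFrame.reduction_frameLift (he : IsMomentumFrame μ e f)
    {q : Phase (Fin (ℓ + 1))} (hq : ∀ σ, m σ ≠ 1 → 0 < q.1 σ) :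
    reduction (frameLift e f q) = q := by
  have hnorm : ∀ σ, ‖e σ‖ = 1 := fun σ => by
    rw [norm_eq_sqrt_real_inner, he.inner_self, Real.sqrt_one]
  refine Prod.ext ?_ ?_ <;> ext σ <;> by_cases h : m σ = 1
  · rw [reduction_fst_of_eq_one _ h, proj_frameLift_fst, PiLp.smul_apply, smul_eq_mul,
      he.apply_of_eq_one σ h, mul_one]
  · rw [reduction_fst_of_ne_one _ h, proj_frameLift_fst, norm_smul, hnorm, mul_one,
      Real.norm_of_nonneg (hq σ h).le]
  · rw [reduction_snd_of_eq_one _ h, proj_frameLift_snd, he.eq_zero_of_eq_one σ h, smul_zero,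
      add_zero, PiLp.smul_apply, smul_eq_mul, he.apply_of_eq_one σ h, mul_one]
  · rw [reduction_snd_of_ne_one _ h, proj_frameLift_fst, proj_frameLift_snd, norm_smul, hnorm,
      mul_one, Real.norm_of_nonneg (hq σ h).le, real_inner_smul_left, inner_add_right,
      real_inner_smul_right, real_inner_smul_right, he.inner_self, he.inner_eq_zero, mul_zero,
      add_zero, mul_one, mul_div_cancel_left₀ _ (hq σ h).ne']

lemma IsMomentumFrame.momentumMap_frameLift (he : IsMomentumFrame μ e f)
    {q : Phase (Fin (ℓ + 1))} (hq : ∀ σ, m σ ≠ 1 → 0 < q.1 σ) :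
    momentumMap (frameLift e f q) = μ := by
  funext σ
  by_cases h : m σ = 1
  · exact momentum_eq_of_eq_one h _ _
  · have hne := (hq σ h).ne'
    apply Subtype.ext
    ext i k
    rw [momentumMap_apply, he.wedge, proj_frameLift_fst, proj_frameLift_snd]
    simp only [PiLp.smul_apply, PiLp.add_apply, smul_eq_mul]
    field_simp
    ring

lemma IsMomentumFrame.frameLift_mem_momentumLevel (he : IsMomentumFrame μ e f)
    {q : Phase (Fin (ℓ + 1))} (hq : ∀ σ, m σ ≠ 1 → 0 < q.1 σ)
    (hqs : q ∈ cotangentSphere (Fin (ℓ + 1))) : frameLift e f q ∈ momentumLevel μ := by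
  have hr := he.reduction_frameLift hq
  refine ⟨⟨?_, ?_⟩, he.momentumMap_frameLift hq⟩
  · rw [← C₁_reduction, hr]
    exact hqs.1
  · rw [← C₂_reduction, hr]
    exact hqs.2

/-- In a block with `m_σ = 1` the coordinate `ξ_σ` may vanish, but there `f_σ = 0`. -/
lemma IsMomentumFrame.contDiffAt_frameLift (he : IsMomentumFrame μ e f)
    {q : Phase (Fin (ℓ + 1))} (hq : ∀ σ, m σ ≠ 1 → 0 < q.1 σ) :
    ContDiffAt ℝ ∞ (frameLift e f) q := by
  have h1 : ∀ σ, ContDiffAt ℝ ∞ (fun q : Phase (Fin (ℓ + 1)) => q.1 σ) q := fun σ => by fun_prop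
  have h2 : ∀ σ, ContDiffAt ℝ ∞ (fun q : Phase (Fin (ℓ + 1)) => q.2 σ) q := fun σ => by fun_prop
  refine ContDiffAt.prodMk (f := fun q => (frameLift e f q).1)
    (g := fun q => (frameLift e f q).2) ?_ ?_
  · rw [contDiffAt_euclidean]
    rintro ⟨σ, i⟩
    exact (h1 σ).mul contDiffAt_const
  · rw [contDiffAt_euclidean]
    rintro ⟨σ, i⟩
    refine ((h2 σ).mul contDiffAt_const).add ?_
    by_cases h : m σ = 1
    · simp only [he.eq_zero_of_eq_one σ h, PiLp.zero_apply, mul_zero]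
      exact contDiffAt_const
    · exact ((h1 σ).inv (hq σ h).ne').mul contDiffAt_const

end Lift

/-! ### The reduced phase space -/

section ReducedSpace

variable {ℓ : ℕ} {m : Fin (ℓ + 1) → ℕ}

lemma proj_fst_ne_zero_of_mem_regularSet (hm : ∀ σ, 1 ≤ m σ) {p : Phase (Idx m)}
    (hp : p ∈ regularSet m) : ∀ σ, m σ ≠ 1 → proj σ p.1 ≠ 0 := by
  intro σ h h0
  refine hp.2 σ (by have := hm σ; omega) ?_
  rw [casimir_momentumMap, h0]
  simp

lemma proj_fst_ne_zero_of_mem_momentumLevel (hm : ∀ σ, 1 ≤ m σ) {μ : Momentum m}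
    (hμ : ∀ σ, 2 ≤ m σ → μ σ ≠ 0) {p : Phase (Idx m)} (hp : p ∈ momentumLevel μ) :
    ∀ σ, m σ ≠ 1 → proj σ p.1 ≠ 0 := by
  intro σ h
  apply proj_fst_ne_zero
  rw [hp.2]
  exact hμ σ (by have := hm σ; omega)

lemma reduction_fst_ne_zero {p : Phase (Idx m)} (hp : p.1 ≠ 0) : (reduction p).1 ≠ 0 := by
  intro h
  have h1 := C₁_reduction p
  rw [C₁, h, inner_zero_left] at h1
  exact hp (inner_self_eq_zero.mp h1.symm)

lemma image_reduction (hm : ∀ σ, 1 ≤ m σ) {μ : Momentum m} (hμ : ∀ σ, 2 ≤ m σ → μ σ ≠ 0)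
    {e f : ∀ σ, EuclideanSpace ℝ (Fin (m σ))} (he : IsMomentumFrame μ e f) :
    reduction '' momentumLevel μ =
      {q | q ∈ cotangentSphere (Fin (ℓ + 1)) ∧ ∀ σ, 2 ≤ m σ → 0 < q.1 σ} := by
  apply Set.Subset.antisymm
  · rintro _ ⟨p, hp, rfl⟩
    exact ⟨reduction_mem_cotangentSphere hp.1, fun σ h => reduction_fst_pos (by omega)
      (proj_fst_ne_zero_of_mem_momentumLevel hm hμ hp σ (by omega))⟩
  · rintro q ⟨hqs, hq⟩
    have hq' : ∀ σ, m σ ≠ 1 → 0 < q.1 σ := fun σ h => hq σ (by have := hm σ; omega)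
    exact ⟨_, he.frameLift_mem_momentumLevel hq' hqs, he.reduction_frameLift hq'⟩

lemma contDiffOn_comp_reduction_iff (hm : ∀ σ, 1 ≤ m σ) {μ : Momentum m}
    (hμ : ∀ σ, 2 ≤ m σ → μ σ ≠ 0) (F : Phase (Fin (ℓ + 1)) → ℝ) :
    ContDiffOn ℝ ∞ F (reduction '' momentumLevel μ) ↔
      ContDiffOn ℝ ∞ (fun p => F (reduction p)) (momentumLevel μ) := by
  have h0 : ∀ p ∈ momentumLevel μ, ∀ σ, m σ ≠ 1 → proj σ p.1 ≠ 0 := fun p hp =>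
    proj_fst_ne_zero_of_mem_momentumLevel hm hμ hp
  constructor
  · intro hF
    exact hF.comp (fun p hp => (contDiffAt_reduction (h0 p hp)).contDiffWithinAt)
      (Set.mapsTo_image _ _)
  · intro hF q hq
    obtain ⟨p, hp, -⟩ := id hq
    obtain ⟨e, f, he⟩ := exists_isMomentumFrame hp.2 (h0 p hp)
    rw [image_reduction hm hμ he] at hq ⊢
    have hpos : ∀ q ∈ {q | q ∈ cotangentSphere (Fin (ℓ + 1)) ∧ ∀ σ, 2 ≤ m σ → 0 < q.1 σ},
        ∀ σ, m σ ≠ 1 → 0 < q.1 σ := fun q hq σ h => hq.2 σ (by have := hm σ; omega)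
    refine (hF.comp (g := fun p => F (reduction p)) (f := frameLift e f)
      (fun q hq => (he.contDiffAt_frameLift (hpos q hq)).contDiffWithinAt)
      (fun q hq => he.frameLift_mem_momentumLevel (hpos q hq) hq.1)).congr ?_ q hq
    intro q hq
    exact (congrArg F (he.reduction_frameLift (hpos q hq))).symm

/-- Orbits of `G̃_μ` are the fibres of the reduction mapping on `L_μ`. -/
lemma exists_mem_tildeGroup_act_eq (hm : ∀ σ, 1 ≤ m σ) {μ : Momentum m}
    (hμ : ∀ σ, 2 ≤ m σ → μ σ ≠ 0) {p q : Phase (Idx m)} (hp : p ∈ momentumLevel μ)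
    (hq : q ∈ momentumLevel μ) (h : reduction p = reduction q) :
    ∃ g ∈ tildeGroup m ⊓ isotropy μ, act g p = q := by
  obtain ⟨g, hg, hgp, hg1⟩ := exists_act_eq (ε := fun _ => 1) hp.2 hq.2
    (proj_fst_ne_zero_of_mem_momentumLevel hm hμ hp)
    (proj_fst_ne_zero_of_mem_momentumLevel hm hμ hq) (fun _ => Or.inl rfl)
    (by rw [← h]; ext σ <;> simp [scaleBy])
  exact ⟨g, ⟨fun σ hσ => hg1 σ (by have := hm σ; omega) rfl, hg⟩, hgp⟩

lemma reduction_act_of_mem_tildeGroup {g : SymGroup m} (hg : g ∈ tildeGroup m)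
    (p : Phase (Idx m)) : reduction (act g p) = reduction p := by
  have h1 : ∀ σ, m σ = 1 → ∀ x : EuclideanSpace ℝ (Idx m), proj σ (rot g x) = proj σ x := by
    intro σ h x
    rw [proj_rot, hg σ (by omega), Submonoid.coe_one, Matrix.one_mulVec]
  refine Prod.ext ?_ ?_ <;> ext σ <;> by_cases h : m σ = 1
  · rw [reduction_fst_of_eq_one _ h, reduction_fst_of_eq_one _ h, act, h1 σ h]
  · exact (reduction_act_of_ne_one g p h).1
  · rw [reduction_snd_of_eq_one _ h, reduction_snd_of_eq_one _ h, act, h1 σ h]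
  · exact (reduction_act_of_ne_one g p h).2

/-- The mapping of the reduced phase space to `T*S^ℓ` induced by the reduction mapping. -/
noncomputable def reducedMap (μ : Momentum m) : ReducedSpace μ → cotangentSphere (Fin (ℓ + 1)) :=
  Quotient.lift (fun p => ⟨reduction p.1, reduction_mem_cotangentSphere p.2.1⟩) (by
    rintro p q ⟨g, hg, h⟩
    apply Subtype.ext
    exact (reduction_act_of_mem_tildeGroup hg.1 p.1).symm.trans (congrArg reduction h))

lemma continuous_reducedMap (hm : ∀ σ, 1 ≤ m σ) {μ : Momentum m}
    (hμ : ∀ σ, 2 ≤ m σ → μ σ ≠ 0) : Continuous (reducedMap μ) := by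
  refine Continuous.quotient_lift (Continuous.subtype_mk ?_ _) _
  exact continuousOn_iff_continuous_domRestrict.mp fun p hp => (contDiffAt_reduction
    (proj_fst_ne_zero_of_mem_momentumLevel hm hμ hp)).continuousAt.continuousWithinAt

/-- The inverse on the image is the class of the smooth section `frameLift`. -/
lemma isOpenEmbedding_reducedMap (hm : ∀ σ, 1 ≤ m σ) {μ : Momentum m}
    (hμ : ∀ σ, 2 ≤ m σ → μ σ ≠ 0) : Topology.IsOpenEmbedding (reducedMap μ) := by
  rcases isEmpty_or_nonempty (ReducedSpace μ) with _ | hne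
  · exact .of_isEmpty _
  obtain ⟨p₀, -⟩ := Quotient.exists_rep hne.some
  obtain ⟨e, f, he⟩ := exists_isMomentumFrame p₀.2.2
    (proj_fst_ne_zero_of_mem_momentumLevel hm hμ p₀.2)
  set U : Set (cotangentSphere (Fin (ℓ + 1))) := {q | ∀ σ, m σ ≠ 1 → 0 < q.1.1 σ} with hU
  have hUo : IsOpen U := by
    simp only [hU, Set.ofPred_forall]
    refine isOpen_iInter_of_finite fun σ => isOpen_iInter_of_finite fun _ => ?_
    exact isOpen_lt continuous_const (by fun_prop)
  have hmem : ∀ z : ReducedSpace μ, reducedMap μ z ∈ U := by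
    rintro ⟨p⟩ σ h
    exact reduction_fst_pos h (proj_fst_ne_zero_of_mem_momentumLevel hm hμ p.2 σ h)
  let Ψ : U → ReducedSpace μ := fun q =>
    Quotient.mk _ ⟨frameLift e f q.1.1, he.frameLift_mem_momentumLevel q.2 q.1.2⟩
  have hΨ : Continuous Ψ := by
    refine continuous_quotient_mk'.comp (Continuous.subtype_mk ?_ _)
    rw [continuous_iff_continuousAt]
    intro q
    exact ContinuousAt.comp (f := fun q : U => q.1.1)
      (he.contDiffAt_frameLift q.2).continuousAt (by fun_prop)
  let Θ : ReducedSpace μ ≃ₜ U :=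
    { toFun := fun z => ⟨reducedMap μ z, hmem z⟩
      invFun := Ψ
      left_inv := by
        rintro ⟨p⟩
        refine Quotient.sound ?_
        exact exists_mem_tildeGroup_act_eq hm hμ (he.frameLift_mem_momentumLevel
          (hmem (Quotient.mk _ p)) (reduction_mem_cotangentSphere p.2.1)) p.2
          (he.reduction_frameLift (hmem (Quotient.mk _ p)))
      right_inv := fun q => Subtype.ext (Subtype.ext (he.reduction_frameLift q.2))
      continuous_toFun := (continuous_reducedMap hm hμ).subtype_mk _
      continuous_invFun := hΨ }
  exact hUo.isOpenEmbedding_subtypeVal.comp Θ.isOpenEmbedding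

lemma exists_isotropy_act_eq_iff (hm : ∀ σ, 1 ≤ m σ) {μ : Momentum m}
    (hμ : ∀ σ, 2 ≤ m σ → μ σ ≠ 0) {p q : Phase (Idx m)} (hp : p ∈ momentumLevel μ)
    (hq : q ∈ momentumLevel μ) :
    (∃ g ∈ isotropy μ, act g p = q) ↔
      ∃ ε : Fin (ℓ + 1) → ℝ, (∀ σ, 2 ≤ m σ → ε σ = 1) ∧ (∀ σ, ε σ = 1 ∨ ε σ = -1) ∧
        reduction q = scaleBy ε (reduction p) := by
  constructor
  · rintro ⟨g, -, rfl⟩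
    have key : ∀ σ, ∃ ε : ℝ, (2 ≤ m σ → ε = 1) ∧ (ε = 1 ∨ ε = -1) ∧
        (reduction (act g p)).1 σ = ε * (reduction p).1 σ ∧
        (reduction (act g p)).2 σ = ε * (reduction p).2 σ := by
      intro σ
      by_cases h : m σ = 1
      · obtain ⟨ε, hε⟩ := exists_sign_reduction_act g p h
        exact ⟨ε, fun h2 => by omega, hε⟩
      · refine ⟨1, fun _ => rfl, Or.inl rfl, ?_, ?_⟩
        · rw [one_mul, (reduction_act_of_ne_one g p h).1]
        · rw [one_mul, (reduction_act_of_ne_one g p h).2]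
    choose ε h1 h2 h3 h4 using key
    refine ⟨ε, h1, h2, Prod.ext ?_ ?_⟩ <;> ext σ
    · exact h3 σ
    · exact h4 σ
  · rintro ⟨ε, -, hε, h⟩
    obtain ⟨g, hg, hgp, -⟩ := exists_act_eq hp.2 hq.2
      (proj_fst_ne_zero_of_mem_momentumLevel hm hμ hp)
      (proj_fst_ne_zero_of_mem_momentumLevel hm hμ hq) hε h
    exact ⟨g, hg, hgp⟩

end ReducedSpace

end NeumannReduction

open NeumannReduction in
theorem mainTheorem1 (ℓ : ℕ) (m : Fin (ℓ + 1) → ℕ) (hm : ∀ σ, 1 ≤ m σ)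
    (b : Fin (ℓ + 1) → ℝ) (hb : StrictMono b) :
    -- the reduction mapping is a Poisson mapping for the Dirac brackets
    (ContDiffOn ℝ ∞ (reduction (m := m)) (regularSet m) ∧
      ∀ p ∈ regularSet m, (reduction p).1 ≠ 0 ∧
        ∀ f g : Phase (Fin (ℓ + 1)) → ℝ,
          DifferentiableAt ℝ f (reduction p) → DifferentiableAt ℝ g (reduction p) →
          diracBracket (fun p => f (reduction p)) (fun p => g (reduction p)) p =
            diracBracket f g (reduction p)) ∧
    ∀ μ : Momentum m, (∀ σ, 2 ≤ m σ → μ σ ≠ 0) →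
      -- the reduction mapping identifies the reduced phase space with an open subset of `T*S^ℓ`
      (∃ Φ : ReducedSpace μ → cotangentSphere (Fin (ℓ + 1)),
        (∀ p : momentumLevel μ, (Φ (Quotient.mk _ p) : Phase (Fin (ℓ + 1))) = reduction p.1) ∧
        Topology.IsOpenEmbedding Φ) ∧
      ((momentumLevel μ).Nonempty → reduction '' momentumLevel μ =
        {q | q ∈ cotangentSphere (Fin (ℓ + 1)) ∧ ∀ σ, 2 ≤ m σ → 0 < q.1 σ}) ∧
      -- this identification respects the smooth functions and the symplectic forms
      (∀ f : Phase (Fin (ℓ + 1)) → ℝ,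
        ContDiffOn ℝ ∞ f (reduction '' momentumLevel μ) ↔
          ContDiffOn ℝ ∞ (fun p => f (reduction p)) (momentumLevel μ)) ∧
      (∀ p ∈ momentumLevel μ, ∀ v ∈ tangentConeAt ℝ (momentumLevel μ) p,
        ∀ w ∈ tangentConeAt ℝ (momentumLevel μ) p,
        symplecticForm (fderiv ℝ reduction p v) (fderiv ℝ reduction p w) =
          symplecticForm v w) ∧
      -- the remaining factors `O(1)` of `G` act by sign changes
      (∀ p ∈ momentumLevel μ, ∀ q ∈ momentumLevel μ,
        (∃ g ∈ isotropy μ, act g p = q) ↔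
          ∃ ε : Fin (ℓ + 1) → ℝ, (∀ σ, 2 ≤ m σ → ε σ = 1) ∧ (∀ σ, ε σ = 1 ∨ ε σ = -1) ∧
            reduction q = scaleBy ε (reduction p)) ∧
      -- the reduced Hamiltonian
      (∀ p ∈ momentumLevel μ,
        neumannHamiltonian b p = rosochatiusHamiltonian b (casimir μ) (reduction p)) := by
  refine ⟨⟨fun p hp => (contDiffAt_reduction
      (proj_fst_ne_zero_of_mem_regularSet hm hp)).contDiffWithinAt, fun p hp =>
      ⟨reduction_fst_ne_zero hp.1, fun f g hf hg =>
        diracBracket_comp_reduction (proj_fst_ne_zero_of_mem_regularSet hm hp) hf hg⟩⟩, ?_⟩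
  intro μ hμ
  have h0 : ∀ p ∈ momentumLevel μ, ∀ σ, m σ ≠ 1 → proj σ p.1 ≠ 0 := fun p hp =>
    proj_fst_ne_zero_of_mem_momentumLevel hm hμ hp
  refine ⟨⟨reducedMap μ, fun p => rfl, isOpenEmbedding_reducedMap hm hμ⟩, ?_,
    contDiffOn_comp_reduction_iff hm hμ, fun p hp v hv w hw =>
      symplecticForm_fderiv_reduction (h0 p hp) hp hv hw,
    fun p hp q hq => exists_isotropy_act_eq_iff hm hμ hp hq, ?_⟩
  · rintro ⟨p, hp⟩
    obtain ⟨e, f, he⟩ := exists_isMomentumFrame hp.2 (h0 p hp)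
    exact image_reduction hm hμ he
  · intro p hp
    rw [neumannHamiltonian_eq_rosochatius b p (h0 p hp), hp.2]
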